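/- Let $(\Gamma,d)$ be a countable metric space. To each $x\in\Gamma$ associate a finite-dimensional complex Hilbert space $\mathcal H_x$; for finite $\Lambda\subset\Gamma$ put $\mathcal H_\Lambda=\bigotimes_{x\in\Lambda}\mathcal H_x$ and $\mathcal A_\Lambda=\mathcal B(\mathcal H_\Lambda)$ with the operator norm. For $Z\subset\Lambda$, an observable $A\in\mathcal A_Z$ is identified with $A\otimes \mathbb 1_{\Lambda\setminus Z}\in\mathcal A_\Lambda$, and a linear map $\Phi$ on $\mathcal A_Z$ with the map $\Phi\otimes\mathrm{id}_{\Lambda\setminus Z}$ on $\mathcal A_\Lambda$. Write $\|\Phi\|_{cb}=\sup_{n\in\mathbb N}\|\Phi\otimes \mathrm{id}_{\mathbb M_n}\|$, and let $CB_0(Y)$ be the set of completely bounded linear maps $K$ on $\mathcal A_Y$ with $K(\mathbb 1_Y)=0$. Let $F:[0,\infty)\to(0,\infty)$ be an $F$-function on $(\Gamma,d)$, i.e. $F$ is non-increasing, $\sup_{x\in\Gamma}\sum_{y\in\Gamma}F(d(x,y))<\infty$, and there is $C>0$ such that $$\sum_{z\in\Gamma}F(d(x,z))F(d(z,y))\le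 C\,F(d(x,y))\qquad\text{for all }x,y\in\Gamma;$$ let $C_F$ be the infimum of all such $C$. Let $\mathscr L=\{L_Z\}$, indexed by the finite subsets $Z\subset\Gamma$, be a dissipative interaction: each $L_Z:\mathcal A_Z\to\mathcal A_Z$ is of Lindblad form $$L_Z(A)=i[H_Z,A]+\sum_{j=1}^{\ell_Z}\Big(K_j^*AK_j-\tfrac12\{K_j^*K_j,A\}\Big),\qquad H_Z=H_Z^*\in\mathcal A_Z,\quad K_1,\dots,K_{\ell_Z}\in\mathcal A_Z .$$ Let $\|\mathscr L\|_F$ be the infimum of all $M\ge 0$ with $\sum_{Z\ni x,y}\|L_Z\|_{cb}\le M\,F(d(x,y))$ for all $x,y\in\Gamma$, and assume $\|\mathscr L\|_F<\infty$. For finite $\Lambda\subset\Gamma$ and $R>0$ set $$\mathscr L^{\Lambda,R}=\sum_{Z\subset\Lambda,\ \mathrm{diam}(Z)\le R}L_Z,\qquad T^{\Lambda,R}_t=\exp\big(t\,\mathscr L^{\Lambda,R}\big),$$ and for $s\ge0$, $k\ge0$ write $\mathscr E_s(k)=\sum_{n=\lceil k\rceil}^\infty \frac{s^n}{n!}$.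 Let $X,Y\subset\Gamma$ be finite with $X\cap Y=\emptyset$, and let $d(X,Y)=\inf\{d(x,y):x\in X,\,y\in Y\}$ (read as $0$ if $X$ or $Y$ is empty). Then for every finite $\Lambda\subset\Gamma$ with $X\cup Y\subset\Lambda$, all $A\in\mathcal A_X$ and $K\in CB_0(Y)$, and all $t\ge0$ and $R>0$, $$\big\|K\big(T^{\Lambda,R}_t(A)\big)\big\|\le\frac{\|K\|_{cb}\,\|A\|}{C_F}\;\mathscr E_{vt}\!\left(\frac{d(X,Y)}{R}\right)\sum_{x\in X}\sum_{y\in Y}F(d(x,y)),\qquad v=\|\mathscr L\|_F\,C_F ,$$ where the right-hand side is read as $0$ if $\Gamma=\emptyset$. -/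

import Mathlib

open scoped NNReal ENNReal Matrix Kronecker Matrix.Norms.L2Operator

noncomputable section

namespace OpenSpin

/-! ### Completely bounded maps on matrix algebras

Square complex matrices carry the operator norm for the Euclidean norm (the C*-norm). -/

section MatrixMaps

variable {m : Type*} [Fintype m] [DecidableEq m]

/-- The map `id ⊗ Φ` on `M_n(ℂ) ⊗ M_m(ℂ)`, realised as `n × n` block matrices with entries in
`M_m(ℂ)`: the map `Φ` is applied to every block. -/
def ampliation (n : Type*) (Φ : Matrix m m ℂ →ₗ[ℂ] Matrix m m ℂ) :
    Matrix (n × m) (n × m) ℂ →ₗ[ℂ] Matrix (n × m) (n × m) ℂ :=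
  (Matrix.compLinearEquiv n n m m ℂ ℂ).toLinearMap ∘ₗ Φ.mapMatrix ∘ₗ
    (Matrix.compLinearEquiv n n m m ℂ ℂ).symm.toLinearMap

/-- The completely bounded norm `sup_n ‖Φ ⊗ 1_{n × n}‖`, with values in `[0, ∞]`. -/
def cbNorm (Φ : Matrix m m ℂ →ₗ[ℂ] Matrix m m ℂ) : ℝ≥0∞ :=
  ⨆ n : ℕ, ‖LinearMap.toContinuousLinearMap (ampliation (Fin n) Φ)‖ₑ

/-- `Φ` is of Lindblad form:
`Φ(A) = i[H, A] + ∑ⱼ (Kⱼ* A Kⱼ - ½ {Kⱼ* Kⱼ, A})` with `H` self-adjoint. -/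
def IsLindblad (Φ : Matrix m m ℂ →ₗ[ℂ] Matrix m m ℂ) : Prop :=
  ∃ H : Matrix m m ℂ, H.IsHermitian ∧ ∃ (l : ℕ) (K : Fin l → Matrix m m ℂ),
    ∀ A : Matrix m m ℂ, Φ A = Complex.I • (H * A - A * H) +
      ∑ j, ((K j)ᴴ * A * K j - (1 / 2 : ℂ) • ((K j)ᴴ * K j * A + A * ((K j)ᴴ * K j)))

end MatrixMaps

/-! ### Quantum spin systems

The finite-dimensional Hilbert space at the site `x` is `ℂ^{ι x}`, i.e. `ι x` indexes an
orthonormal basis of it.  The tensor product over a finite volume `Λ` has the product basis, which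
is indexed by the configurations `∀ x : Λ, ι x`. -/

section SpinSystem

variable {Γ : Type*} [DecidableEq Γ] (ι : Γ → Type*) [∀ x, Fintype (ι x)] [∀ x, DecidableEq (ι x)]

/-- Indices of the product basis of `⨂_{x ∈ Λ} ℂ^{ι x}`. -/
abbrev Config (Λ : Finset Γ) : Type _ := ∀ x : Λ, ι x

/-- The algebra of observables in the finite volume `Λ`, with its C*-norm. -/
abbrev LocalAlg (Λ : Finset Γ) : Type _ := Matrix (Config ι Λ) (Config ι Λ) ℂ

variable {ι}

/-- For `Z ⊆ Λ`, a configuration on `Λ` is a pair of configurations on `Λ \ Z` and on `Z`; this is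
the factorisation `H_Λ = H_{Λ \ Z} ⊗ H_Z`. -/
def splitConfig {Z Λ : Finset Γ} (h : Z ⊆ Λ) :
    Config ι Λ ≃ Config ι (Λ \ Z) × Config ι Z where
  toFun σ := (fun x => σ ⟨x, (Finset.mem_sdiff.1 x.2).1⟩, fun x => σ ⟨x, h x.2⟩)
  invFun p x := if hx : (x : Γ) ∈ Z then p.2 ⟨x, hx⟩ else p.1 ⟨x, Finset.mem_sdiff.2 ⟨x.2, hx⟩⟩
  left_inv σ := by
    funext x
    by_cases hx : (x : Γ) ∈ Z <;> simp [hx]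
  right_inv p := by
    refine Prod.ext ?_ ?_
    · funext x
      have hx : (x : Γ) ∉ Z := (Finset.mem_sdiff.1 x.2).2
      simp [hx]
    · funext x
      simp

/-- The embedding `A_Z → A_Λ`, `A ↦ 1_{Λ \ Z} ⊗ A`, for `Z ⊆ Λ`. -/
def embed {Z Λ : Finset Γ} (h : Z ⊆ Λ) (A : LocalAlg ι Z) : LocalAlg ι Λ :=
  ((1 : LocalAlg ι (Λ \ Z)) ⊗ₖ A).submatrix (splitConfig h) (splitConfig h)

/-- The map `id_{Λ \ Z} ⊗ Φ` on `A_Λ` that a map `Φ` on `A_Z` induces, for `Z ⊆ Λ`. -/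
def extend {Z Λ : Finset Γ} (h : Z ⊆ Λ) (Φ : LocalAlg ι Z →ₗ[ℂ] LocalAlg ι Z) :
    LocalAlg ι Λ →ₗ[ℂ] LocalAlg ι Λ :=
  let e := Matrix.reindexLinearEquiv ℂ ℂ (splitConfig (ι := ι) h) (splitConfig (ι := ι) h)
  e.symm.toLinearMap ∘ₗ ampliation (Config ι (Λ \ Z)) Φ ∘ₗ e.toLinearMap

/-- `CB₀(Y)`: the completely bounded maps on `A_Y` that vanish at the identity. -/
def CB₀ (Y : Finset Γ) : Set (LocalAlg ι Y →ₗ[ℂ] LocalAlg ι Y) :=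
  {K | cbNorm K < ∞ ∧ K 1 = 0}

/-- The family `L` is a dissipative interaction: each `L_Z` is of Lindblad form on `A_Z`. -/
def IsDissipativeInteraction (L : ∀ Z : Finset Γ, LocalAlg ι Z →ₗ[ℂ] LocalAlg ι Z) : Prop :=
  ∀ Z, IsLindblad (L Z)

end SpinSystem

/-! ### Decay functions and dynamics -/

section Metric

variable {Γ : Type*} [MetricSpace Γ]

/-- `C` satisfies `∑_z F(d(x,z)) F(d(z,y)) ≤ C F(d(x,y))` for all `x, y`. -/
def IsConvBound (Γ : Type*) [MetricSpace Γ] (F : ℝ≥0 → ℝ≥0) (C : ℝ≥0) : Prop :=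
  ∀ x y : Γ, ∑' z : Γ, (F (nndist x z) * F (nndist z y) : ℝ≥0∞) ≤ C * F (nndist x y)

/-- `F : [0, ∞) → (0, ∞)` is an `F`-function on `Γ`. -/
structure IsFFunction (Γ : Type*) [MetricSpace Γ] (F : ℝ≥0 → ℝ≥0) : Prop where
  pos : ∀ r, 0 < F r
  antitone : Antitone F
  uniformlySummable : ⨆ x : Γ, ∑' y : Γ, (F (nndist x y) : ℝ≥0∞) < ∞
  convolution : ∃ C : ℝ≥0, 0 < C ∧ IsConvBound Γ F C

/-- The convolution constant `C_F`. -/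
def convConst (Γ : Type*) [MetricSpace Γ] (F : ℝ≥0 → ℝ≥0) : ℝ≥0 :=
  sInf {C : ℝ≥0 | 0 < C ∧ IsConvBound Γ F C}

/-- The distance `d(X, Y) = inf {d(x, y) : x ∈ X, y ∈ Y}` (and `0` if `X` or `Y` is empty). -/
def setDist (X Y : Finset Γ) : ℝ := ⨅ p : X × Y, dist (p.1 : Γ) (p.2 : Γ)

variable [DecidableEq Γ] {ι : Γ → Type*} [∀ x, Fintype (ι x)] [∀ x, DecidableEq (ι x)]

/-- The `F`-norm `‖𝓛‖_F ∈ [0, ∞]`: the infimum of the `M` such that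
`∑_{Z ∋ x, y} ‖L_Z‖_cb ≤ M F(d(x,y))` for all `x, y`. -/
def FNorm (F : ℝ≥0 → ℝ≥0) (L : ∀ Z : Finset Γ, LocalAlg ι Z →ₗ[ℂ] LocalAlg ι Z) : ℝ≥0∞ :=
  sInf {M : ℝ≥0∞ | ∀ x y : Γ,
    ∑' Z : {Z : Finset Γ // x ∈ Z ∧ y ∈ Z}, cbNorm (L Z) ≤ M * F (nndist x y)}

/-- The generator `𝓛^{Λ,R} = ∑_{Z ⊆ Λ, diam Z ≤ R} L_Z` on `A_Λ`. -/
def truncGen (L : ∀ Z : Finset Γ, LocalAlg ι Z →ₗ[ℂ] LocalAlg ι Z) (Λ : Finset Γ) (R : ℝ) :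
    LocalAlg ι Λ →ₗ[ℂ] LocalAlg ι Λ :=
  ∑ Z ∈ Λ.powerset.attach with Metric.diam (Z.1 : Set Γ) ≤ R,
    extend (Finset.mem_powerset.1 Z.2) (L Z.1)

/-- The dynamics `T_t^{Λ,R} = exp(t 𝓛^{Λ,R})` on `A_Λ`. -/
def truncDyn (L : ∀ Z : Finset Γ, LocalAlg ι Z →ₗ[ℂ] LocalAlg ι Z) (Λ : Finset Γ) (R t : ℝ) :
    LocalAlg ι Λ →L[ℂ] LocalAlg ι Λ :=
  NormedSpace.exp ((t : ℂ) • LinearMap.toContinuousLinearMap (truncGen L Λ R))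

end Metric

/-- The tail `∑_{n ≥ ⌈k⌉} tⁿ / n!` of the exponential series. -/
def expTail (t k : ℝ) : ℝ :=
  ∑' n : {n : ℕ // ⌈k⌉₊ ≤ n}, t ^ (n : ℕ) / (Nat.factorial n : ℝ)

end OpenSpin

end

/-!
The part of the generator supported off `Y` commutes with `K` and generates contractions, so
`‖K (T_t A)‖` grows only through the `L_Z` with `Z` overlapping `Y`. Since `L_Z` vanishes at `1`, it
can in turn play the role of `K`; iterating bounds `‖K (T_t A)‖` by `‖K‖ ‖A‖` times the sum over `j`
of `t ^ j / j!` times the weight of the chains of `j` consecutively overlapping sets that lead from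
`Y` to `X`. A chain of `j` sets of diameter at most `R` covers a distance of at most `j * R`, so
only `j ≥ d(X, Y) / R` contribute, and summing over the sites at which consecutive sets overlap
bounds the weight of these chains by
`‖𝓛‖_F ^ j * C_F ^ (j - 1) * ∑ x ∈ X, ∑ y ∈ Y, F (d(x, y))`.
-/

namespace OpenSpin

open Filter Topology

noncomputable section

/-! ### Dissipative maps -/

section Dissipative

variable {V : Type*} [NormedAddCommGroup V] [NormedSpace ℝ V]

/-- `D` generates contractions to first order: an Euler step `v ↦ v + h D v` increases the norm
only at second order in `h`. For bounded linear `D` this is a uniform form of dissipativity in the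
sense of semigroup theory. -/
def IsDissipative (D : V → V) : Prop :=
  ∃ c : ℝ, ∀ h : ℝ, 0 ≤ h → ∀ v, ‖v + h • D v‖ ≤ (1 + c * h ^ 2) * ‖v‖

theorem IsDissipative.zero : IsDissipative (0 : V → V) :=
  ⟨0, fun h _ v => by simp⟩

theorem IsDissipative.add {D E : V → V} (hD : IsDissipative D) (hE : IsDissipative E) :
    IsDissipative (D + E) := by
  obtain ⟨c, hc⟩ := hD
  obtain ⟨d, hd⟩ := hE
  refine ⟨2 * c + 2 * d, fun h hh v => ?_⟩
  have average : v + h • (D + E) v =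
      (1 / 2 : ℝ) • ((v + (2 * h) • D v) + (v + (2 * h) • E v)) := by
    rw [Pi.add_apply]
    module
  calc ‖v + h • (D + E) v‖
      ≤ 1 / 2 * (‖v + (2 * h) • D v‖ + ‖v + (2 * h) • E v‖) := by
        rw [average, norm_smul, Real.norm_of_nonneg (by norm_num)]
        gcongr
        exact norm_add_le _ _
    _ ≤ 1 / 2 * ((1 + c * (2 * h) ^ 2) * ‖v‖ + (1 + d * (2 * h) ^ 2) * ‖v‖) := by
        gcongr
        exacts [hc _ (by positivity) v, hd _ (by positivity) v]
    _ = (1 + (2 * c + 2 * d) * h ^ 2) * ‖v‖ := by ring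

theorem IsDissipative.sum {I : Type*} (s : Finset I) {D : I → V → V}
    (hD : ∀ i ∈ s, IsDissipative (D i)) : IsDissipative (∑ i ∈ s, D i) :=
  Finset.sum_induction D IsDissipative (fun _ _ => .add) .zero hD

theorem IsDissipative.eventually_slope_norm_lt {D : V → V} (hD : IsDissipative D) {f : ℝ → V}
    {u : V} {x r : ℝ} (hf : HasDerivAt f (D (f x) + u) x) (hu : ‖u‖ < r) :
    ∀ᶠ z in 𝓝[>] x, slope (fun s => ‖f s‖) x z < r := by
  obtain ⟨c, hc⟩ := hD
  have error_tendsto : Tendsto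
      (fun z => c * (z - x) * ‖f x‖ + ‖u‖ + ‖slope f x z - (D (f x) + u)‖) (𝓝[>] x) (𝓝 ‖u‖) := by
    have hlin : Tendsto (fun z => c * (z - x) * ‖f x‖) (𝓝[>] x) (𝓝 0) :=
      (Continuous.tendsto' (by fun_prop) x 0 (by simp)).mono_left nhdsWithin_le_nhds
    have hslope := ((hasDerivAt_iff_tendsto_slope.1 hf).mono_left
      (nhdsWithin_mono x fun z (hz : x < z) => hz.ne')).sub_const (D (f x) + u)
    rw [sub_self] at hslope
    simpa using (hlin.add_const ‖u‖).add hslope.norm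
  filter_upwards [error_tendsto.eventually (gt_mem_nhds hu), self_mem_nhdsWithin] with z hz hxz
  have hh : 0 < z - x := sub_pos.2 hxz
  have euler_step : f z = (f x + (z - x) • D (f x)) + (z - x) • u +
      (z - x) • (slope f x z - (D (f x) + u)) := by
    rw [smul_sub, sub_smul_slope, smul_add, vsub_eq_sub]
    abel
  have norm_step : ‖f z‖ ≤ (1 + c * (z - x) ^ 2) * ‖f x‖ + (z - x) * ‖u‖ +
      (z - x) * ‖slope f x z - (D (f x) + u)‖ := by
    conv_lhs => rw [euler_step]
    refine norm_add₃_le.trans ?_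
    rw [norm_smul, norm_smul, Real.norm_of_nonneg hh.le]
    gcongr
    exact hc _ hh.le _
  refine lt_of_le_of_lt ?_ hz
  rw [slope_def_field, div_le_iff₀ hh]
  linear_combination norm_step

theorem IsDissipative.norm_le_of_hasDerivAt {D : V → V} (hD : IsDissipative D) {f g : ℝ → V}
    {B B' : ℝ → ℝ} (hf : ∀ s, HasDerivAt f (D (f s) + g s) s)
    (hB : ∀ s, HasDerivAt B (B' s) s) (hg : ∀ s, 0 ≤ s → ‖g s‖ ≤ B' s) (h0 : ‖f 0‖ ≤ B 0)
    {t : ℝ} (ht : 0 ≤ t) : ‖f t‖ ≤ B t := by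
  have hfc : Continuous f := continuous_iff_continuousAt.2 fun s => (hf s).continuousAt
  have hBc : Continuous B := continuous_iff_continuousAt.2 fun s => (hB s).continuousAt
  exact image_le_of_liminf_slope_right_le_deriv_boundary hfc.norm.continuousOn h0
    hBc.continuousOn (fun s _ => (hB s).hasDerivWithinAt)
    (fun s hs r hr => (hD.eventually_slope_norm_lt (hf s) ((hg s hs.1).trans_lt hr)).frequently)
    ⟨ht, le_rfl⟩

theorem IsDissipative.norm_le_norm_zero {D : V → V} (hD : IsDissipative D) {f : ℝ → V}
    (hf : ∀ s, HasDerivAt f (D (f s)) s) {t : ℝ} (ht : 0 ≤ t) : ‖f t‖ ≤ ‖f 0‖ :=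
  hD.norm_le_of_hasDerivAt (g := 0) (B := fun _ => ‖f 0‖) (by simpa using hf)
    (fun s => hasDerivAt_const s _) (by simp) le_rfl ht

end Dissipative

/-! ### Duhamel's expansion -/

section Overlap

variable {Γ : Type*} [DecidableEq Γ]

/-- The transfer operator of the cluster expansion: it sums `w Z * u Z` over the sets `Z ∈ P` that
overlap `Y`, so its iterates sum over chains of consecutively overlapping sets starting at `Y`. -/
def overlapSum (P : Finset (Finset Γ)) (w u : Finset Γ → ℝ) (Y : Finset Γ) : ℝ :=
  ∑ Z ∈ P with ¬Disjoint Y Z, w Z * u Z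

/-- The indicator function of the sets that meet `X`, the terminal weight of the chains that
connect to `X`. -/
def meetIndicator (X Y : Finset Γ) : ℝ := if Disjoint Y X then 0 else 1

/-- What `n` iterations of Duhamel's formula give for the evolution of an observable in `X` as
seen from `Y`: `j` iterations contribute the chains of length `j` from `Y` to `X`, and the remainder
contributes all chains of length `n`. -/
def duhamelMajorant (P : Finset (Finset Γ)) (w : Finset Γ → ℝ) (X : Finset Γ) (n : ℕ)
    (Y : Finset Γ) (t : ℝ) : ℝ :=
  ∑ j ∈ Finset.range n, t ^ j / (j.factorial : ℝ) * (overlapSum P w)^[j] (meetIndicator X) Y +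
    t ^ n / (n.factorial : ℝ) * (overlapSum P w)^[n] 1 Y

variable {P : Finset (Finset Γ)} {w : Finset Γ → ℝ} {X Y : Finset Γ}

theorem meetIndicator_nonneg : 0 ≤ meetIndicator X :=
  fun Y => by rw [meetIndicator]; positivity

theorem overlapSum_mono (hw : 0 ≤ w) : Monotone (overlapSum P w) :=
  fun _ _ huv _ => Finset.sum_le_sum fun Z _ => mul_le_mul_of_nonneg_left (huv Z) (hw Z)

theorem iterate_overlapSum_nonneg (hw : 0 ≤ w) {u : Finset Γ → ℝ} (hu : 0 ≤ u) (n : ℕ) :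
    0 ≤ (overlapSum P w)^[n] u := by
  induction n with
  | zero => exact hu
  | succ n ih =>
    rw [Function.iterate_succ_apply']
    exact fun Y => Finset.sum_nonneg fun Z _ => mul_nonneg (hw Z) (ih Z)

theorem iterate_overlapSum_one_le (hw : 0 ≤ w) (n : ℕ) (Y : Finset Γ) :
    (overlapSum P w)^[n] 1 Y ≤ (∑ Z ∈ P, w Z) ^ n := by
  induction n generalizing Y with
  | zero => simp
  | succ n ih =>
    rw [Function.iterate_succ_apply', pow_succ', Finset.sum_mul]
    calc overlapSum P w ((overlapSum P w)^[n] 1) Y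
        ≤ overlapSum P w (fun _ => (∑ Z ∈ P, w Z) ^ n) Y := overlapSum_mono hw ih Y
      _ ≤ ∑ Z ∈ P, w Z * (∑ Z ∈ P, w Z) ^ n :=
        Finset.sum_le_sum_of_subset_of_nonneg (Finset.filter_subset _ _) fun Z _ _ =>
          mul_nonneg (hw Z) (pow_nonneg (Finset.sum_nonneg fun Z _ => hw Z) n)

theorem duhamelMajorant_zero (t : ℝ) : duhamelMajorant P w X 0 Y t = 1 := by
  simp [duhamelMajorant]

theorem duhamelMajorant_succ_zero (n : ℕ) :
    duhamelMajorant P w X (n + 1) Y 0 = meetIndicator X Y := by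
  simp [duhamelMajorant, Finset.sum_range_succ']

theorem duhamelMajorant_nonneg (hw : 0 ≤ w) (n : ℕ) {t : ℝ} (ht : 0 ≤ t) :
    0 ≤ duhamelMajorant P w X n Y t :=
  add_nonneg
    (Finset.sum_nonneg fun j _ => mul_nonneg (by positivity)
      (iterate_overlapSum_nonneg hw meetIndicator_nonneg j Y))
    (mul_nonneg (by positivity) (iterate_overlapSum_nonneg hw zero_le_one n Y))

theorem hasDerivAt_pow_succ_div_factorial (n : ℕ) (t : ℝ) :
    HasDerivAt (fun s : ℝ => s ^ (n + 1) / ((n + 1).factorial : ℝ))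
      (t ^ n / (n.factorial : ℝ)) t := by
  refine ((hasDerivAt_pow (n + 1) t).div_const _).congr_deriv ?_
  rw [Nat.factorial_succ]
  push_cast
  field_simp

theorem hasDerivAt_duhamelMajorant_succ (n : ℕ) (t : ℝ) :
    HasDerivAt (duhamelMajorant P w X (n + 1) Y)
      (overlapSum P w (fun Z => duhamelMajorant P w X n Z t) Y) t := by
  have overlapSum_majorant : overlapSum P w (fun Z => duhamelMajorant P w X n Z t) Y =
      ∑ j ∈ Finset.range n, t ^ j / (j.factorial : ℝ) *
        (overlapSum P w)^[j + 1] (meetIndicator X) Y +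
      t ^ n / (n.factorial : ℝ) * (overlapSum P w)^[n + 1] 1 Y := by
    simp only [Function.iterate_succ_apply', overlapSum, duhamelMajorant, mul_add,
      Finset.mul_sum, Finset.sum_add_distrib, mul_left_comm (w _)]
    rw [Finset.sum_comm]
  rw [overlapSum_majorant]
  unfold duhamelMajorant
  simp only [Finset.sum_range_succ' _ n, pow_zero]
  exact ((HasDerivAt.fun_sum fun j _ =>
    (hasDerivAt_pow_succ_div_factorial j t).mul_const _).add_const _).add
      ((hasDerivAt_pow_succ_div_factorial n t).mul_const _)

end Overlap

section Duhamel

variable {Γ : Type*} [DecidableEq Γ] {V : Type*} [NormedAddCommGroup V] [NormedSpace ℝ V]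

/-- The abstract locality of a map `κ` supported in `Y`, relative to a family of local generators
`E Z`, `Z ∈ P`, and an observable `A` supported in `X`. -/
structure IsLocalizedIn (P : Finset (Finset Γ)) (E : Finset Γ → V →L[ℝ] V) (X : Finset Γ) (A : V)
    (Y : Finset Γ) (κ : V →L[ℝ] V) : Prop where
  comm : ∀ Z ∈ P, Disjoint Y Z → ∀ v, κ (E Z v) = E Z (κ v)
  map_eq_zero : Disjoint Y X → κ A = 0

variable {P : Finset (Finset Γ)} {w : Finset Γ → ℝ} {E : Finset Γ → V →L[ℝ] V} {X Y : Finset Γ}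
  {A : V} {f : ℝ → V} {κ : V →L[ℝ] V}

theorem IsLocalizedIn.hasDerivAt (hκ : IsLocalizedIn P E X A Y κ) {t : ℝ}
    (hf : HasDerivAt f (∑ Z ∈ P, E Z (f t)) t) :
    HasDerivAt (fun s => κ (f s)) ((∑ Z ∈ P with Disjoint Y Z, ⇑(E Z)) (κ (f t)) +
      ∑ Z ∈ P with ¬Disjoint Y Z, κ (E Z (f t))) t := by
  refine (κ.hasFDerivAt.comp_hasDerivAt t hf).congr_deriv ?_
  rw [map_sum, ← Finset.sum_filter_add_sum_filter_not P (fun Z => Disjoint Y Z), Finset.sum_apply]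
  congr 1
  refine Finset.sum_congr rfl fun Z hZ => ?_
  obtain ⟨hZP, hYZ⟩ := Finset.mem_filter.1 hZ
  exact hκ.comm Z hZP hYZ _

theorem IsLocalizedIn.norm_apply_le (hw : 0 ≤ w) (hdiss : ∀ Z ∈ P, IsDissipative (E Z))
    (hnorm : ∀ Z ∈ P, Z.Nonempty → ‖E Z‖ ≤ w Z)
    (hloc : ∀ Z ∈ P, IsLocalizedIn P E X (f 0) Z (E Z))
    (hf : ∀ s, HasDerivAt f (∑ Z ∈ P, E Z (f s)) s) (hκ : IsLocalizedIn P E X (f 0) Y κ) (n : ℕ)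
    {t : ℝ} (ht : 0 ≤ t) : ‖κ (f t)‖ ≤ ‖κ‖ * ‖f 0‖ * duhamelMajorant P w X n Y t := by
  induction n generalizing Y κ t with
  | zero =>
    rw [duhamelMajorant_zero, mul_one]
    exact κ.le_opNorm_of_le
      ((IsDissipative.sum P hdiss).norm_le_norm_zero (by simpa only [Finset.sum_apply] using hf) ht)
  | succ n ih =>
    have hdissY : IsDissipative (∑ Z ∈ P with Disjoint Y Z, ⇑(E Z)) :=
      IsDissipative.sum _ fun Z hZ => hdiss Z (Finset.mem_filter.1 hZ).1
    refine hdissY.norm_le_of_hasDerivAt (fun s => hκ.hasDerivAt (hf s))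
      (fun s => (hasDerivAt_duhamelMajorant_succ n s).const_mul _) (fun s hs => ?_) ?_ ht
    · rw [overlapSum, Finset.mul_sum]
      refine norm_sum_le_of_le _ fun Z hZ => ?_
      obtain ⟨hZP, hYZ⟩ := Finset.mem_filter.1 hZ
      have hZne : Z.Nonempty := Finset.nonempty_iff_ne_empty.2 fun h => hYZ (by simp [h])
      have hmaj := duhamelMajorant_nonneg (P := P) (X := X) (Y := Z) hw n hs
      calc ‖κ (E Z (f s))‖
          ≤ ‖κ‖ * (‖E Z‖ * ‖f 0‖ * duhamelMajorant P w X n Z s) :=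
            κ.le_opNorm_of_le (ih (hloc Z hZP) hs)
        _ ≤ ‖κ‖ * (w Z * ‖f 0‖ * duhamelMajorant P w X n Z s) := by
            gcongr
            exact hnorm Z hZP hZne
        _ = ‖κ‖ * ‖f 0‖ * (w Z * duhamelMajorant P w X n Z s) := by ring
    · rw [duhamelMajorant_succ_zero, meetIndicator]
      split_ifs with hYX
      · simp [hκ.map_eq_zero hYX]
      · simpa using κ.le_opNorm (f 0)

end Duhamel

/-! ### Lindblad generators and ampliations -/

section Lindblad

variable {m n : Type*} [Fintype m] [Fintype n] [DecidableEq n]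

theorem IsLindblad.exists_kraus_form {Φ : Matrix m m ℂ →ₗ[ℂ] Matrix m m ℂ} (h : IsLindblad Φ) :
    ∃ (G : Matrix m m ℂ) (l : ℕ) (K : Fin l → Matrix m m ℂ),
      ∀ A, Φ A = Gᴴ * A + A * G + ∑ j, (K j)ᴴ * A * K j := by
  obtain ⟨H, hH, l, K, hΦ⟩ := h
  set N := ∑ j, (K j)ᴴ * K j with hN
  have hN_adj : Nᴴ = N := by simp [hN, Matrix.conjTranspose_sum]
  have hG_adj : (-(Complex.I • H) - (1 / 2 : ℂ) • N)ᴴ = Complex.I • H - (1 / 2 : ℂ) • N := by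
    simp [hN_adj, hH.eq]
  refine ⟨-(Complex.I • H) - (1 / 2 : ℂ) • N, l, K, fun A => ?_⟩
  rw [hΦ, hG_adj, Finset.sum_sub_distrib, ← Finset.smul_sum, Finset.sum_add_distrib,
    ← Finset.sum_mul, ← Finset.mul_sum, ← hN]
  simp only [smul_sub, smul_add, sub_mul, mul_sub, Matrix.smul_mul, Matrix.mul_smul, mul_neg]
  abel

variable [DecidableEq m]

theorem norm_one_kronecker_le (A : Matrix m m ℂ) : ‖(1 : Matrix n n ℂ) ⊗ₖ A‖ ≤ ‖A‖ := by
  let kroneckerHom : Matrix m m ℂ →⋆ₙₐ[ℂ] Matrix (n × m) (n × m) ℂ :=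
    { toFun := fun A => 1 ⊗ₖ A
      map_smul' := fun c A => Matrix.kronecker_smul c 1 A
      map_zero' := Matrix.kronecker_zero 1
      map_add' := Matrix.kronecker_add 1
      map_mul' := fun A B => by rw [← Matrix.mul_kronecker_mul, one_mul]
      map_star' := fun A => by
        simp only [Matrix.star_eq_conjTranspose, Matrix.conjTranspose_kronecker,
          Matrix.conjTranspose_one] }
  exact NonUnitalStarAlgHom.norm_apply_le kroneckerHom A

theorem norm_submatrix_equiv (e : n ≃ m) (A : Matrix m m ℂ) : ‖A.submatrix e e‖ = ‖A‖ := by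
  let submatrixHom : Matrix m m ℂ →⋆ₙₐ[ℂ] Matrix n n ℂ :=
    { toFun := fun A => A.submatrix e e
      map_smul' := fun _ _ => rfl
      map_zero' := rfl
      map_add' := fun _ _ => rfl
      map_mul' := fun A B => (Matrix.submatrix_mul_equiv A B e e e).symm
      map_star' := fun _ => rfl }
  exact NonUnitalStarAlgHom.norm_map submatrixHom (Matrix.reindex e.symm e.symm).injective A

theorem norm_sum_conjTranspose_mul_mul_le {I : Type*} [Fintype I] (V : I → Matrix m m ℂ)
    (A : Matrix m m ℂ) : ‖∑ i, (V i)ᴴ * A * V i‖ ≤ ‖∑ i, (V i)ᴴ * V i‖ * ‖A‖ := by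
  classical
  let W : Matrix (I × m) m ℂ := Matrix.of fun p b => V p.1 p.2 b
  have stinespring : ∀ B : Matrix m m ℂ,
      ∑ i, (V i)ᴴ * B * V i = Wᴴ * ((1 : Matrix I I ℂ) ⊗ₖ B) * W := by
    intro B
    ext a b
    simp only [Matrix.sum_apply, Matrix.mul_apply, Fintype.sum_prod_type, W,
      Matrix.conjTranspose_apply, Matrix.of_apply, Matrix.kroneckerMap_apply, Matrix.one_apply,
      ite_mul, one_mul, zero_mul, mul_ite, mul_zero, Finset.sum_ite_irrel, Finset.sum_const_zero,
      Finset.sum_ite_eq', Finset.mem_univ, if_true]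
  have stinespring_one : ∑ i, (V i)ᴴ * V i = Wᴴ * W := by
    simpa only [mul_one, Matrix.one_kronecker_one, Matrix.mul_one] using stinespring 1
  rw [stinespring A, stinespring_one, Matrix.l2_opNorm_conjTranspose_mul_self]
  calc ‖Wᴴ * ((1 : Matrix I I ℂ) ⊗ₖ A) * W‖
      ≤ ‖Wᴴ‖ * ‖(1 : Matrix I I ℂ) ⊗ₖ A‖ * ‖W‖ :=
        (Matrix.l2_opNorm_mul _ _).trans (by gcongr; exact Matrix.l2_opNorm_mul _ _)
    _ ≤ ‖W‖ * ‖A‖ * ‖W‖ := by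
        rw [Matrix.l2_opNorm_conjTranspose]
        gcongr
        exact norm_one_kronecker_le A
    _ = ‖W‖ * ‖W‖ * ‖A‖ := by ring

/-- The Kraus operators of a completely positive map that agrees with the Euler step
`A ↦ A + s (Gᴴ A + A G + ∑ⱼ Kⱼᴴ A Kⱼ)` up to second order in `s ≥ 0`. -/
def krausStep {J : Type*} (G : Matrix m m ℂ) (K : J → Matrix m m ℂ) (s : ℝ) :
    Option J → Matrix m m ℂ
  | none => 1 + (s : ℂ) • G
  | some j => (√s : ℂ) • K j

theorem sum_conj_krausStep {J : Type*} [Fintype J] (G : Matrix m m ℂ) (K : J → Matrix m m ℂ)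
    {s : ℝ} (hs : 0 ≤ s) (A : Matrix m m ℂ) :
    ∑ o, (krausStep G K s o)ᴴ * A * krausStep G K s o =
      A + (s : ℂ) • (Gᴴ * A + A * G + ∑ j, (K j)ᴴ * A * K j) + (s : ℂ) ^ 2 • (Gᴴ * A * G) := by
  have sqrt_mul_sqrt : (√s : ℂ) * (√s : ℂ) = s := by
    rw [← Complex.ofReal_mul, Real.mul_self_sqrt hs]
  simp only [Fintype.sum_option, krausStep, Matrix.conjTranspose_add, Matrix.conjTranspose_one,
    Matrix.conjTranspose_smul, Complex.star_def, Complex.conj_ofReal, add_mul, mul_add, one_mul,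
    mul_one, Matrix.smul_mul, Matrix.mul_smul, smul_smul, sqrt_mul_sqrt, smul_add, Finset.smul_sum,
    sq]
  abel

theorem IsLindblad.map_one {Φ : Matrix m m ℂ →ₗ[ℂ] Matrix m m ℂ} (h : IsLindblad Φ) :
    Φ 1 = 0 := by
  obtain ⟨H, -, l, K, hΦ⟩ := h
  rw [hΦ]
  simp [← two_smul ℂ, smul_smul]

theorem IsLindblad.isDissipative {Φ : Matrix m m ℂ →ₗ[ℂ] Matrix m m ℂ} (h : IsLindblad Φ) :
    IsDissipative Φ := by
  obtain ⟨G, l, K, hΦ⟩ := h.exists_kraus_form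
  refine ⟨2 * ‖G‖ ^ 2, fun s hs A => ?_⟩
  have norm_sq_smul : ∀ B : Matrix m m ℂ, ‖(s : ℂ) ^ 2 • (Gᴴ * B * G)‖ ≤ s ^ 2 * ‖G‖ ^ 2 * ‖B‖ := by
    intro B
    have hB : ‖Gᴴ * B * G‖ ≤ ‖G‖ * ‖B‖ * ‖G‖ := by
      simpa only [Matrix.l2_opNorm_conjTranspose] using norm_mul₃_le (a := Gᴴ) (b := B) (c := G)
    rw [norm_smul, norm_pow, Complex.norm_real, Real.norm_of_nonneg hs]
    linear_combination s ^ 2 * hB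
  have euler_step : ∀ B, B + s • Φ B =
      ∑ o, (krausStep G K s o)ᴴ * B * krausStep G K s o - (s : ℂ) ^ 2 • (Gᴴ * B * G) := by
    intro B
    rw [sum_conj_krausStep G K hs, add_sub_cancel_right, ← hΦ]
    rfl
  have norm_one_le : ‖(1 : Matrix m m ℂ)‖ ≤ 1 := by
    cases isEmpty_or_nonempty m
    · simp [Subsingleton.elim (1 : Matrix m m ℂ) 0]
    · exact CStarRing.norm_one.le
  have norm_kraus_le : ‖∑ o, (krausStep G K s o)ᴴ * krausStep G K s o‖ ≤ 1 + s ^ 2 * ‖G‖ ^ 2 := by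
    have hone := euler_step 1
    rw [h.map_one, smul_zero, add_zero, eq_sub_iff_add_eq] at hone
    simp only [mul_one] at hone
    have := norm_sq_smul 1
    rw [mul_one] at this
    rw [← hone]
    refine (norm_add_le _ _).trans (add_le_add norm_one_le (this.trans ?_))
    exact mul_le_of_le_one_right (by positivity) norm_one_le
  calc ‖A + s • Φ A‖
      ≤ ‖∑ o, (krausStep G K s o)ᴴ * A * krausStep G K s o‖ + ‖(s : ℂ) ^ 2 • (Gᴴ * A * G)‖ := by
        rw [euler_step]
        exact norm_sub_le _ _
    _ ≤ (1 + s ^ 2 * ‖G‖ ^ 2) * ‖A‖ + s ^ 2 * ‖G‖ ^ 2 * ‖A‖ := by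
        gcongr
        exacts [(norm_sum_conjTranspose_mul_mul_le _ A).trans (by gcongr), norm_sq_smul A]
    _ = (1 + 2 * ‖G‖ ^ 2 * s ^ 2) * ‖A‖ := by ring

end Lindblad

section Ampliation

variable {m n : Type*}

theorem ampliation_apply (Φ : Matrix m m ℂ →ₗ[ℂ] Matrix m m ℂ) (M : Matrix (n × m) (n × m) ℂ)
    (p q : n × m) :
    ampliation n Φ M p q = Φ (M.submatrix (Prod.mk p.1) (Prod.mk q.1)) p.2 q.2 := rfl

variable [Fintype m] [Fintype n]

theorem submatrix_one_kronecker_mul [DecidableEq n] (P : Matrix m m ℂ)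
    (M : Matrix (n × m) (n × m) ℂ) (i j : n) :
    (((1 : Matrix n n ℂ) ⊗ₖ P) * M).submatrix (Prod.mk i) (Prod.mk j) =
      P * M.submatrix (Prod.mk i) (Prod.mk j) := by
  ext a b
  simp [Matrix.mul_apply, Fintype.sum_prod_type, Matrix.one_apply, Finset.sum_ite_irrel]

theorem submatrix_mul_one_kronecker [DecidableEq n] (P : Matrix m m ℂ)
    (M : Matrix (n × m) (n × m) ℂ) (i j : n) :
    (M * ((1 : Matrix n n ℂ) ⊗ₖ P)).submatrix (Prod.mk i) (Prod.mk j) =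
      M.submatrix (Prod.mk i) (Prod.mk j) * P := by
  ext a b
  simp [Matrix.mul_apply, Fintype.sum_prod_type, Matrix.one_apply, Finset.sum_ite_irrel]

theorem IsLindblad.ampliation {Φ : Matrix m m ℂ →ₗ[ℂ] Matrix m m ℂ} (h : IsLindblad Φ) :
    IsLindblad (OpenSpin.ampliation n Φ) := by
  classical
  obtain ⟨H, hH, l, K, hΦ⟩ := h
  refine ⟨(1 : Matrix n n ℂ) ⊗ₖ H, ?_, l, fun j => (1 : Matrix n n ℂ) ⊗ₖ K j, fun M => ?_⟩
  · rw [Matrix.IsHermitian, Matrix.conjTranspose_kronecker, hH.eq, Matrix.conjTranspose_one]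
  · ext ⟨i, a⟩ ⟨j, b⟩
    have entry (N : Matrix (n × m) (n × m) ℂ) :
        N (i, a) (j, b) = N.submatrix (Prod.mk i) (Prod.mk j) a b := rfl
    rw [ampliation_apply, hΦ]
    simp only [Matrix.conjTranspose_kronecker, Matrix.conjTranspose_one,
      ← Matrix.mul_kronecker_mul, Matrix.one_mul, Matrix.add_apply, Matrix.sub_apply,
      Matrix.smul_apply, Matrix.sum_apply]
    simp only [entry, submatrix_mul_one_kronecker, submatrix_one_kronecker_mul]

variable [DecidableEq m] [DecidableEq n]

theorem norm_ampliation_le {Φ : Matrix m m ℂ →ₗ[ℂ] Matrix m m ℂ} (hΦ : cbNorm Φ < ∞)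
    (M : Matrix (n × m) (n × m) ℂ) : ‖ampliation n Φ M‖ ≤ (cbNorm Φ).toReal * ‖M‖ := by
  let e : n × m ≃ Fin (Fintype.card n) × m := (Fintype.equivFin n).prodCongr (Equiv.refl m)
  have reindexed : ampliation n Φ M =
      (ampliation (Fin (Fintype.card n)) Φ (M.submatrix e.symm e.symm)).submatrix e e := by
    ext p q
    simp only [ampliation_apply, Matrix.submatrix_submatrix, Matrix.submatrix_apply]
    simp [e, Function.comp_def]
  rw [reindexed, norm_submatrix_equiv, ← norm_submatrix_equiv e.symm M]
  refine (LinearMap.toContinuousLinearMap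
    (ampliation (Fin (Fintype.card n)) Φ)).le_of_opNorm_le ?_ _
  rw [← toReal_enorm]
  exact ENNReal.toReal_mono hΦ.ne
    (le_iSup (fun k : ℕ => ‖LinearMap.toContinuousLinearMap (ampliation (Fin k) Φ)‖ₑ) _)

end Ampliation

/-! ### Locality of extended maps -/

section LocalMaps

variable {Γ : Type*} [DecidableEq Γ] {ι : Γ → Type*} {X Y Z Λ : Finset Γ}

/-- The configuration that agrees with `a` on `Z` and with `σ` elsewhere. -/
def paste (h : Z ⊆ Λ) (σ : Config ι Λ) (a : Config ι Z) : Config ι Λ :=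
  (splitConfig h).symm ((splitConfig h σ).1, a)

theorem paste_apply (h : Z ⊆ Λ) (σ : Config ι Λ) (a : Config ι Z) (x : Λ) :
    paste h σ a x = if hx : (x : Γ) ∈ Z then a ⟨x, hx⟩ else σ x := rfl

theorem paste_comm (hY : Y ⊆ Λ) (hZ : Z ⊆ Λ) (hYZ : Disjoint Y Z) (σ : Config ι Λ)
    (a : Config ι Y) (b : Config ι Z) :
    paste hY (paste hZ σ b) a = paste hZ (paste hY σ a) b := by
  funext x
  simp only [paste_apply]
  split_ifs with hxY hxZ
  exacts [(Finset.disjoint_left.1 hYZ hxY hxZ).elim, rfl, rfl, rfl]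

theorem restrict₂_paste (hY : Y ⊆ Λ) (hZ : Z ⊆ Λ) (hYZ : Disjoint Y Z) (σ : Config ι Λ)
    (b : Config ι Z) : Finset.restrict₂ hY (paste hZ σ b) = Finset.restrict₂ hY σ :=
  funext fun x => dif_neg (Finset.disjoint_left.1 hYZ x.2)

theorem extend_eq_submatrix (h : Z ⊆ Λ) (Φ : LocalAlg ι Z →ₗ[ℂ] LocalAlg ι Z) (M : LocalAlg ι Λ) :
    extend h Φ M = (ampliation (Config ι (Λ \ Z)) Φ
      (M.submatrix (splitConfig h).symm (splitConfig h).symm)).submatrix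
        (splitConfig h) (splitConfig h) := rfl

theorem extend_apply (h : Z ⊆ Λ) (Φ : LocalAlg ι Z →ₗ[ℂ] LocalAlg ι Z) (M : LocalAlg ι Λ)
    (σ τ : Config ι Λ) : extend h Φ M σ τ =
      Φ (M.submatrix (paste h σ) (paste h τ)) (Finset.restrict₂ h σ) (Finset.restrict₂ h τ) := rfl

theorem extend_apply_eq_sum [∀ x, Fintype (ι x)] [∀ x, DecidableEq (ι x)] (h : Z ⊆ Λ)
    (Φ : LocalAlg ι Z →ₗ[ℂ] LocalAlg ι Z) (M : LocalAlg ι Λ) (σ τ : Config ι Λ) :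
    extend h Φ M σ τ = ∑ p : Config ι Z × Config ι Z, M (paste h σ p.1) (paste h τ p.2) *
      Φ (Matrix.single p.1 p.2 1) (Finset.restrict₂ h σ) (Finset.restrict₂ h τ) := by
  rw [extend_apply, Matrix.matrix_eq_sum_single (M.submatrix _ _)]
  simp only [map_sum, Matrix.sum_apply, Fintype.sum_prod_type]
  refine Finset.sum_congr rfl fun a _ => Finset.sum_congr rfl fun b _ => ?_
  rw [← smul_eq_mul, ← Matrix.smul_apply, ← map_smul, Matrix.smul_single, smul_eq_mul, mul_one,
    Matrix.submatrix_apply]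

theorem extend_comm [∀ x, Finite (ι x)] (hY : Y ⊆ Λ) (hZ : Z ⊆ Λ) (hYZ : Disjoint Y Z)
    (Φ : LocalAlg ι Y →ₗ[ℂ] LocalAlg ι Y) (Ψ : LocalAlg ι Z →ₗ[ℂ] LocalAlg ι Z)
    (M : LocalAlg ι Λ) : extend hY Φ (extend hZ Ψ M) = extend hZ Ψ (extend hY Φ M) := by
  classical
  have (x : Γ) : Fintype (ι x) := Fintype.ofFinite (ι x)
  ext σ τ
  simp only [extend_apply_eq_sum, Finset.sum_mul, restrict₂_paste hY hZ hYZ,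
    restrict₂_paste hZ hY hYZ.symm, paste_comm hY hZ hYZ]
  rw [Finset.sum_comm]
  simp only [mul_right_comm]

variable [∀ x, DecidableEq (ι x)]

theorem embed_apply (h : X ⊆ Λ) (A : LocalAlg ι X) (σ τ : Config ι Λ) :
    embed h A σ τ = if ∀ x : Λ, (x : Γ) ∉ X → σ x = τ x then
      A (Finset.restrict₂ h σ) (Finset.restrict₂ h τ) else 0 := by
  have agree_iff : (splitConfig h σ).1 = (splitConfig h τ).1 ↔
      ∀ x : Λ, (x : Γ) ∉ X → σ x = τ x := by
    simp only [splitConfig, Equiv.coe_fn_mk, funext_iff, Subtype.forall, Finset.mem_sdiff]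
    exact ⟨fun H x hx hxX => H x ⟨hx, hxX⟩, fun H x hx => H x hx.1 hx.2⟩
  simp only [embed, Matrix.submatrix_apply, Matrix.kroneckerMap_apply, Matrix.one_apply, agree_iff,
    ite_mul, one_mul, zero_mul]
  rfl

theorem embed_submatrix_paste (hX : X ⊆ Λ) (hZ : Z ⊆ Λ) (hZX : Disjoint Z X) (A : LocalAlg ι X)
    (σ τ : Config ι Λ) : (embed hX A).submatrix (paste hZ σ) (paste hZ τ) =
      (if ∀ x : Λ, (x : Γ) ∉ X → (x : Γ) ∉ Z → σ x = τ x then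
        A (Finset.restrict₂ hX σ) (Finset.restrict₂ hX τ) else 0) • (1 : LocalAlg ι Z) := by
  ext a b
  have agree_iff : (∀ x : Λ, (x : Γ) ∉ X → paste hZ σ a x = paste hZ τ b x) ↔
      a = b ∧ ∀ x : Λ, (x : Γ) ∉ X → (x : Γ) ∉ Z → σ x = τ x := by
    simp only [paste_apply]
    constructor
    · refine fun H => ⟨funext fun x => ?_, fun x hxX hxZ => ?_⟩
      · simpa using H ⟨x, hZ x.2⟩ (Finset.disjoint_left.1 hZX x.2)
      · simpa [hxZ] using H x hxX
    · rintro ⟨rfl, H⟩ x hxX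
      split_ifs with hxZ
      exacts [rfl, H x hxX hxZ]
  simp only [Matrix.submatrix_apply, embed_apply, agree_iff, restrict₂_paste hX hZ hZX.symm,
    Matrix.smul_apply, Matrix.one_apply, smul_eq_mul, mul_ite, mul_one, mul_zero, ite_and]

theorem extend_embed_eq_zero (hX : X ⊆ Λ) (hZ : Z ⊆ Λ) (hZX : Disjoint Z X)
    {Φ : LocalAlg ι Z →ₗ[ℂ] LocalAlg ι Z} (hΦ : Φ 1 = 0) (A : LocalAlg ι X) :
    extend hZ Φ (embed hX A) = 0 := by
  ext σ τ
  rw [extend_apply, embed_submatrix_paste hX hZ hZX, map_smul, hΦ, smul_zero]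
  rfl

variable [∀ x, Fintype (ι x)]

theorem norm_embed_le (h : X ⊆ Λ) (A : LocalAlg ι X) : ‖embed h A‖ ≤ ‖A‖ := by
  rw [embed, norm_submatrix_equiv]
  exact norm_one_kronecker_le A

theorem norm_extend_le (h : Z ⊆ Λ) {Φ : LocalAlg ι Z →ₗ[ℂ] LocalAlg ι Z} (hΦ : cbNorm Φ < ∞)
    (M : LocalAlg ι Λ) : ‖extend h Φ M‖ ≤ (cbNorm Φ).toReal * ‖M‖ := by
  rw [extend_eq_submatrix, norm_submatrix_equiv, ← norm_submatrix_equiv (splitConfig h).symm M]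
  exact norm_ampliation_le hΦ _

theorem IsLindblad.isDissipative_extend (h : Z ⊆ Λ) {Φ : LocalAlg ι Z →ₗ[ℂ] LocalAlg ι Z}
    (hΦ : IsLindblad Φ) : IsDissipative (extend h Φ) := by
  obtain ⟨c, hc⟩ := (hΦ.ampliation (n := Config ι (Λ \ Z))).isDissipative
  refine ⟨c, fun s hs M => ?_⟩
  have hM := hc s hs (M.submatrix (splitConfig h).symm (splitConfig h).symm)
  rw [norm_submatrix_equiv, ← norm_submatrix_equiv (splitConfig h)] at hM
  convert hM using 1
  congr 1
  ext σ τ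
  simp [extend_eq_submatrix]

end LocalMaps

/-! ### Sums over chains -/

section ChainSum

variable {Γ : Type*} [DecidableEq Γ] {P : Finset (Finset Γ)} {w u : Finset Γ → ℝ} {Λ X : Finset Γ}

theorem overlapSum_le_sum_mem (hw : 0 ≤ w) (hu : 0 ≤ u) (Y : Finset Γ) :
    overlapSum P w u Y ≤ ∑ y ∈ Y, ∑ Z ∈ P with y ∈ Z, w Z * u Z := by
  have term_nonneg (Z : Finset Γ) : 0 ≤ w Z * u Z := mul_nonneg (hw Z) (hu Z)
  simp only [overlapSum, Finset.sum_filter]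
  rw [Finset.sum_comm]
  refine Finset.sum_le_sum fun Z _ => ?_
  split_ifs with hYZ
  · exact Finset.sum_nonneg fun y _ => by split_ifs; exacts [term_nonneg Z, le_rfl]
  · obtain ⟨y, hy, hyZ⟩ := Finset.not_disjoint_iff.1 hYZ
    rw [← Finset.sum_filter]
    exact Finset.single_le_sum (f := fun _ => w Z * u Z) (fun _ _ => term_nonneg Z)
      (Finset.mem_filter.2 ⟨hy, hyZ⟩)

theorem sum_mem_mul_sum (hP : ∀ Z ∈ P, Z ⊆ Λ) (w : Finset Γ → ℝ) (g : Γ → ℝ) (y : Γ) :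
    ∑ Z ∈ P with y ∈ Z, w Z * ∑ z ∈ Z, g z =
      ∑ z ∈ Λ, (∑ Z ∈ P with y ∈ Z ∧ z ∈ Z, w Z) * g z := by
  simp only [Finset.sum_mul, ← Finset.filter_filter, Finset.mul_sum]
  exact Finset.sum_comm' fun Z z => by
    simp only [Finset.mem_filter]
    exact ⟨fun h => ⟨⟨h.1, h.2⟩, hP Z h.1.1 h.2⟩, fun h => h.1⟩

theorem overlapSum_sum_le (hw : 0 ≤ w) (hP : ∀ Z ∈ P, Z ⊆ Λ) {b : Γ → Γ → ℝ}
    (hb : ∀ y z, ∑ Z ∈ P with y ∈ Z ∧ z ∈ Z, w Z ≤ b y z) {g : Γ → ℝ} (hg : 0 ≤ g)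
    (Y : Finset Γ) :
    overlapSum P w (fun Z => ∑ z ∈ Z, g z) Y ≤ ∑ y ∈ Y, ∑ z ∈ Λ, b y z * g z := by
  refine (overlapSum_le_sum_mem hw (fun Z => Finset.sum_nonneg fun z _ => hg z) Y).trans ?_
  simp only [sum_mem_mul_sum hP]
  gcongr with y _ z _
  exacts [hg z, hb y z]

theorem meetIndicator_le_sum (Z : Finset Γ) :
    meetIndicator X Z ≤ ∑ z ∈ Z, if z ∈ X then 1 else 0 := by
  rw [meetIndicator, Finset.sum_boole]
  split_ifs with hZX
  · positivity
  · obtain ⟨z, hz, hzX⟩ := Finset.not_disjoint_iff.1 hZX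
    exact_mod_cast Finset.card_pos.2 ⟨z, Finset.mem_filter.2 ⟨hz, hzX⟩⟩

theorem iterate_overlapSum_meetIndicator_le (hw : 0 ≤ w) (hP : ∀ Z ∈ P, Z ⊆ Λ) {f : Γ → Γ → ℝ}
    (hf : ∀ x y, 0 ≤ f x y) {M C : ℝ} (hM : 0 ≤ M) (hC : 0 ≤ C)
    (hb : ∀ x y, ∑ Z ∈ P with x ∈ Z ∧ y ∈ Z, w Z ≤ M * f x y)
    (hconv : ∀ x y, ∑ z ∈ Λ, f x z * f z y ≤ C * f x y) (n : ℕ) (Y : Finset Γ) :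
    (overlapSum P w)^[n + 1] (meetIndicator X) Y ≤
      M ^ (n + 1) * C ^ n * ∑ y ∈ Y, ∑ x ∈ X, f y x := by
  induction n generalizing Y with
  | zero =>
    have hX : (0 : Γ → ℝ) ≤ fun z => if z ∈ X then 1 else 0 := fun z => by positivity
    calc overlapSum P w (meetIndicator X) Y
        ≤ overlapSum P w (fun Z => ∑ z ∈ Z, if z ∈ X then 1 else 0) Y :=
          overlapSum_mono hw meetIndicator_le_sum Y
      _ ≤ ∑ y ∈ Y, ∑ z ∈ Λ, M * f y z * if z ∈ X then 1 else 0 :=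
          overlapSum_sum_le hw hP hb hX Y
      _ = M * ∑ y ∈ Y, ∑ x ∈ Λ ∩ X, f y x := by
          simp only [mul_ite, mul_one, mul_zero, ← Finset.sum_filter, Finset.filter_mem_eq_inter,
            Finset.mul_sum]
      _ ≤ M * ∑ y ∈ Y, ∑ x ∈ X, f y x := by
          gcongr with y _
          exacts [fun x _ _ => hf y x, Finset.inter_subset_right]
      _ = M ^ (0 + 1) * C ^ 0 * ∑ y ∈ Y, ∑ x ∈ X, f y x := by ring
  | succ n ih =>
    have hg : 0 ≤ fun z => M ^ (n + 1) * C ^ n * ∑ x ∈ X, f z x := fun z =>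
      mul_nonneg (by positivity) (Finset.sum_nonneg fun x _ => hf z x)
    rw [Function.iterate_succ_apply']
    calc overlapSum P w ((overlapSum P w)^[n + 1] (meetIndicator X)) Y
        ≤ overlapSum P w (fun Z => ∑ z ∈ Z, M ^ (n + 1) * C ^ n * ∑ x ∈ X, f z x) Y :=
          overlapSum_mono hw (fun Z => (ih Z).trans_eq (Finset.mul_sum ..)) Y
      _ ≤ ∑ y ∈ Y, ∑ z ∈ Λ, M * f y z * (M ^ (n + 1) * C ^ n * ∑ x ∈ X, f z x) :=
          overlapSum_sum_le hw hP hb hg Y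
      _ = M ^ (n + 2) * C ^ n * ∑ y ∈ Y, ∑ x ∈ X, ∑ z ∈ Λ, f y z * f z x := by
          simp only [Finset.mul_sum, Finset.sum_comm (s := X)]
          congr! 3
          ring
      _ ≤ M ^ (n + 2) * C ^ n * ∑ y ∈ Y, ∑ x ∈ X, C * f y x := by
          gcongr with y _ x _
          exact hconv y x
      _ = M ^ (n + 1 + 1) * C ^ (n + 1) * ∑ y ∈ Y, ∑ x ∈ X, f y x := by
          simp only [← Finset.mul_sum]
          ring

theorem exists_dist_le_of_iterate_overlapSum_ne_zero {Γ : Type*} [PseudoMetricSpace Γ]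
    [DecidableEq Γ] {P : Finset (Finset Γ)} {w : Finset Γ → ℝ} {X Y : Finset Γ} {R : ℝ}
    (hP : ∀ Z ∈ P, Metric.diam (Z : Set Γ) ≤ R) {n : ℕ}
    (h : (overlapSum P w)^[n] (meetIndicator X) Y ≠ 0) :
    ∃ x ∈ X, ∃ y ∈ Y, dist x y ≤ n * R := by
  induction n generalizing Y with
  | zero =>
    have hYX : ¬Disjoint Y X := fun hd => h (if_pos hd)
    obtain ⟨z, hzY, hzX⟩ := Finset.not_disjoint_iff.1 hYX
    exact ⟨z, hzX, z, hzY, by simp⟩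
  | succ n ih =>
    rw [Function.iterate_succ_apply', overlapSum] at h
    obtain ⟨Z, hZ, hne⟩ := Finset.exists_ne_zero_of_sum_ne_zero h
    obtain ⟨hZP, hYZ⟩ := Finset.mem_filter.1 hZ
    obtain ⟨x, hx, z, hz, hxz⟩ := ih (right_ne_zero_of_mul hne)
    obtain ⟨y, hyY, hyZ⟩ := Finset.not_disjoint_iff.1 hYZ
    have hzy : dist z y ≤ R :=
      (Metric.dist_le_diam_of_mem Z.finite_toSet.isBounded hz hyZ).trans (hP Z hZP)
    refine ⟨x, hx, y, hyY, (dist_triangle x z y).trans ?_⟩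
    push_cast
    linarith

theorem setDist_le_dist {Γ : Type*} [MetricSpace Γ] {X Y : Finset Γ} {x y : Γ} (hx : x ∈ X)
    (hy : y ∈ Y) : setDist X Y ≤ dist x y :=
  ciInf_le (f := fun p : X × Y => dist (p.1 : Γ) (p.2 : Γ)) (Set.finite_range _).bddBelow
    (⟨x, hx⟩, ⟨y, hy⟩)

theorem iterate_overlapSum_eq_zero_of_lt {Γ : Type*} [MetricSpace Γ] [DecidableEq Γ]
    {P : Finset (Finset Γ)} {w : Finset Γ → ℝ} {X Y : Finset Γ} {R : ℝ} (hR : 0 < R)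
    (hP : ∀ Z ∈ P, Metric.diam (Z : Set Γ) ≤ R) {n : ℕ} (hn : n < ⌈setDist X Y / R⌉₊) :
    (overlapSum P w)^[n] (meetIndicator X) Y = 0 := by
  by_contra h
  obtain ⟨x, hx, y, hy, hxy⟩ := exists_dist_le_of_iterate_overlapSum_ne_zero hP h
  have hlt : n * R < setDist X Y := (lt_div_iff₀ hR).1 (Nat.lt_ceil.1 hn)
  exact ((setDist_le_dist hx hy).trans hxy).not_gt hlt

end ChainSum

section ExpTail

theorem hasSum_expTail (s k : ℝ) :
    HasSum ({j : ℕ | ⌈k⌉₊ ≤ j}.indicator fun j => s ^ j / (j.factorial : ℝ)) (expTail s k) :=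
  (hasSum_subtype_iff_indicator (s := {j : ℕ | ⌈k⌉₊ ≤ j})).1
    ((Real.summable_pow_div_factorial s).subtype _).hasSum

theorem sum_pow_div_factorial_mul_le_expTail {t v c k : ℝ} (ht : 0 ≤ t) (hv : 0 ≤ v) (hc : 0 ≤ c)
    {a : ℕ → ℝ} (ha₀ : ∀ j < ⌈k⌉₊, a j = 0) (ha : ∀ j, a j ≤ c * v ^ j) (n : ℕ) :
    ∑ j ∈ Finset.range n, t ^ j / (j.factorial : ℝ) * a j ≤ c * expTail (v * t) k := by
  set e := {j : ℕ | ⌈k⌉₊ ≤ j}.indicator fun j => (v * t) ^ j / (j.factorial : ℝ) with he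
  have e_nonneg (j : ℕ) : 0 ≤ e j := Set.indicator_nonneg (fun j _ => by positivity) j
  have term_le (j : ℕ) : t ^ j / (j.factorial : ℝ) * a j ≤ c * e j := by
    rcases lt_or_ge j ⌈k⌉₊ with hj | hj
    · rw [ha₀ j hj, mul_zero]
      exact mul_nonneg hc (e_nonneg j)
    · calc t ^ j / (j.factorial : ℝ) * a j ≤ t ^ j / (j.factorial : ℝ) * (c * v ^ j) := by
            gcongr
            exact ha j
        _ = c * e j := by
            rw [he, Set.indicator_of_mem (show j ∈ {j | ⌈k⌉₊ ≤ j} from hj)]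
            ring
  calc ∑ j ∈ Finset.range n, t ^ j / (j.factorial : ℝ) * a j
      ≤ c * ∑ j ∈ Finset.range n, e j := by
        rw [Finset.mul_sum]
        exact Finset.sum_le_sum fun j _ => term_le j
    _ ≤ c * expTail (v * t) k := by
        gcongr
        exact sum_le_hasSum _ (fun j _ => e_nonneg j) (hasSum_expTail _ _)

end ExpTail

section Interaction

variable {Γ : Type*} [MetricSpace Γ] {F : ℝ≥0 → ℝ≥0}

theorem isConvBound_convConst (h : ∃ C, IsConvBound Γ F C) : IsConvBound Γ F (convConst Γ F) := by
  intro x y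
  obtain ⟨C, hC⟩ := h
  have hC' : IsConvBound Γ F (C + 1) := fun x y => (hC x y).trans (by gcongr; exact le_self_add)
  have hne : {C : ℝ≥0 | 0 < C ∧ IsConvBound Γ F C}.Nonempty := ⟨C + 1, by positivity, hC'⟩
  have := hne.to_subtype
  rw [convConst, sInf_eq_iInf', ENNReal.coe_iInf, ENNReal.iInf_mul (by simp)]
  exact le_iInf fun D => D.2.2 x y

theorem convConst_pos [Nonempty Γ] (hF₀ : 0 < F 0) (h : ∃ C, IsConvBound Γ F C) :
    0 < convConst Γ F := by
  obtain ⟨x⟩ := ‹Nonempty Γ›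
  have diagonal := (ENNReal.le_tsum x).trans (isConvBound_convConst h x x)
  rw [nndist_self] at diagonal
  have hmul : 0 < convConst Γ F * F 0 :=
    (mul_pos hF₀ hF₀).trans_le (by exact_mod_cast diagonal)
  exact pos_of_mul_pos_left hmul hF₀.le

theorem sum_mul_le_convConst (h : ∃ C, IsConvBound Γ F C) (Λ : Finset Γ) (x y : Γ) :
    ∑ z ∈ Λ, (F (nndist x z) : ℝ) * F (nndist z y) ≤ convConst Γ F * F (nndist x y) := by
  have h := (ENNReal.sum_le_tsum Λ).trans (isConvBound_convConst h x y)
  exact_mod_cast h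

variable [DecidableEq Γ] {ι : Γ → Type*} [∀ x, Fintype (ι x)] [∀ x, DecidableEq (ι x)]
  {L : ∀ Z : Finset Γ, LocalAlg ι Z →ₗ[ℂ] LocalAlg ι Z}

theorem tsum_cbNorm_le (hLF : FNorm F L < ∞) (x y : Γ) :
    ∑' Z : {Z : Finset Γ // x ∈ Z ∧ y ∈ Z}, cbNorm (L Z) ≤ FNorm F L * F (nndist x y) := by
  obtain ⟨M, hM, -⟩ := sInf_lt_iff.1 hLF
  have : Nonempty {M : ℝ≥0∞ | ∀ x y : Γ,
    ∑' Z : {Z : Finset Γ // x ∈ Z ∧ y ∈ Z}, cbNorm (L Z) ≤ M * F (nndist x y)} := ⟨⟨M, hM⟩⟩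
  rw [FNorm, sInf_eq_iInf', ENNReal.iInf_mul (by simp)]
  exact le_iInf fun M => M.2 x y

theorem cbNorm_lt_top (hLF : FNorm F L < ∞) {Z : Finset Γ} (hZ : Z.Nonempty) :
    cbNorm (L Z) < ∞ := by
  obtain ⟨x, hx⟩ := hZ
  calc cbNorm (L Z) ≤ ∑' Z : {Z : Finset Γ // x ∈ Z ∧ x ∈ Z}, cbNorm (L Z) :=
        ENNReal.le_tsum (f := fun Z : {Z : Finset Γ // x ∈ Z ∧ x ∈ Z} => cbNorm (L Z)) ⟨Z, hx, hx⟩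
    _ ≤ FNorm F L * F (nndist x x) := tsum_cbNorm_le hLF x x
    _ < ∞ := ENNReal.mul_lt_top hLF ENNReal.coe_lt_top

theorem sum_cbNorm_le (hLF : FNorm F L < ∞) (P : Finset (Finset Γ)) (x y : Γ) :
    ∑ Z ∈ P with x ∈ Z ∧ y ∈ Z, (cbNorm (L Z)).toReal ≤
      (FNorm F L).toReal * F (nndist x y) := by
  have sum_le : ∑ Z ∈ P with x ∈ Z ∧ y ∈ Z, cbNorm (L Z) ≤ FNorm F L * F (nndist x y) := by
    rw [← Finset.sum_subtype_eq_sum_filter]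
    exact (ENNReal.sum_le_tsum _).trans (tsum_cbNorm_le hLF x y)
  rw [← ENNReal.toReal_sum fun Z hZ => (cbNorm_lt_top hLF ⟨x, (Finset.mem_filter.1 hZ).2.1⟩).ne,
    ← ENNReal.coe_toReal, ← ENNReal.toReal_mul]
  exact ENNReal.toReal_mono (ENNReal.mul_lt_top hLF ENNReal.coe_lt_top).ne sum_le

end Interaction

/-! ### The truncated dynamics -/

section LocalTerm

variable {Γ : Type*} [DecidableEq Γ] {ι : Γ → Type*} [∀ x, Fintype (ι x)]
  {L : ∀ Z : Finset Γ, LocalAlg ι Z →ₗ[ℂ] LocalAlg ι Z} {P : Finset (Finset Γ)} {X Y Z Λ : Finset Γ}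

/-- The contribution of `L_Z` to the generator in the volume `Λ`, extended by `0` to the sets
`Z ⊄ Λ`. It is regarded as a real-linear map because time is real. -/
def localTerm (L : ∀ Z : Finset Γ, LocalAlg ι Z →ₗ[ℂ] LocalAlg ι Z) (Λ Z : Finset Γ) :
    LocalAlg ι Λ →L[ℝ] LocalAlg ι Λ :=
  if h : Z ⊆ Λ then (LinearMap.toContinuousLinearMap (extend h (L Z))).restrictScalars ℝ else 0

theorem localTerm_apply (h : Z ⊆ Λ) (M : LocalAlg ι Λ) :
    localTerm L Λ Z M = extend h (L Z) M := by
  rw [localTerm, dif_pos h]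
  rfl

variable [∀ x, DecidableEq (ι x)]

theorem norm_localTerm_le (hZ : Z ⊆ Λ) (hL : cbNorm (L Z) < ∞) :
    ‖localTerm L Λ Z‖ ≤ (cbNorm (L Z)).toReal :=
  ContinuousLinearMap.opNorm_le_bound _ ENNReal.toReal_nonneg fun M =>
    localTerm_apply (L := L) hZ M ▸ norm_extend_le hZ hL M

theorem isDissipative_localTerm (hZ : Z ⊆ Λ) (hL : IsLindblad (L Z)) :
    IsDissipative (localTerm L Λ Z) :=
  funext (localTerm_apply (L := L) hZ) ▸ hL.isDissipative_extend hZ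

theorem isLocalizedIn_extend (hP : ∀ Z ∈ P, Z ⊆ Λ) (hX : X ⊆ Λ) (hY : Y ⊆ Λ) (A : LocalAlg ι X)
    {K : LocalAlg ι Y →ₗ[ℂ] LocalAlg ι Y} (hK : K 1 = 0) :
    IsLocalizedIn P (localTerm L Λ) X (embed hX A) Y
      ((LinearMap.toContinuousLinearMap (extend hY K)).restrictScalars ℝ) where
  comm Z hZ hYZ M := by
    simp only [localTerm_apply (hP Z hZ)]
    exact extend_comm hY (hP Z hZ) hYZ K (L Z) M
  map_eq_zero hYX := extend_embed_eq_zero hX hY hYX hK A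

theorem isLocalizedIn_localTerm (hP : ∀ Z ∈ P, Z ⊆ Λ) (hX : X ⊆ Λ) (hZ : Z ⊆ Λ)
    (A : LocalAlg ι X) (hL : L Z 1 = 0) :
    IsLocalizedIn P (localTerm L Λ) X (embed hX A) Z (localTerm L Λ Z) := by
  rw [localTerm.eq_def L Λ Z, dif_pos hZ]
  exact isLocalizedIn_extend hP hX hZ A hL

end LocalTerm

section Dynamics

theorem hasDerivAt_exp_smul_apply {V : Type*} [NormedAddCommGroup V] [NormedSpace ℂ V]
    [CompleteSpace V] (S : V →L[ℂ] V) (A : V) (s : ℝ) :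
    HasDerivAt (fun u : ℝ => NormedSpace.exp ((u : ℂ) • S) A)
      (S (NormedSpace.exp ((s : ℂ) • S) A)) s := by
  have hexp : HasDerivAt (fun u : ℝ => NormedSpace.exp ((u : ℂ) • S))
      (S * NormedSpace.exp ((s : ℂ) • S)) s := by
    simpa using! (hasDerivAt_exp_smul_const' (𝕂 := ℂ) S (s : ℂ)).scomp s
      Complex.ofRealCLM.hasDerivAt
  exact ((ContinuousLinearMap.apply ℂ V A).restrictScalars ℝ).hasFDerivAt.comp_hasDerivAt s hexp

variable {Γ : Type*} [MetricSpace Γ]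

/-- The subsets of `Λ` of diameter at most `R`, which index the terms of `truncGen L Λ R`. -/
def smallSubsets (Λ : Finset Γ) (R : ℝ) : Finset (Finset Γ) :=
  {Z ∈ Λ.powerset | Metric.diam (Z : Set Γ) ≤ R}

theorem subset_of_mem_smallSubsets {Z Λ : Finset Γ} {R : ℝ} (hZ : Z ∈ smallSubsets Λ R) : Z ⊆ Λ :=
  Finset.mem_powerset.1 (Finset.mem_filter.1 hZ).1

variable [DecidableEq Γ] {ι : Γ → Type*} [∀ x, Fintype (ι x)]
  {L : ∀ Z : Finset Γ, LocalAlg ι Z →ₗ[ℂ] LocalAlg ι Z} {F : ℝ≥0 → ℝ≥0} {X Y Λ : Finset Γ} {R t : ℝ}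

theorem truncGen_apply (M : LocalAlg ι Λ) :
    truncGen L Λ R M = ∑ Z ∈ smallSubsets Λ R, localTerm L Λ Z M := by
  rw [truncGen, LinearMap.sum_apply, smallSubsets, Finset.sum_filter, Finset.sum_filter,
    ← Finset.sum_attach Λ.powerset]
  simp only [localTerm_apply (Finset.mem_powerset.1 (Subtype.prop _))]

variable [∀ x, DecidableEq (ι x)]

theorem hasDerivAt_truncDyn_apply (M : LocalAlg ι Λ) (s : ℝ) :
    HasDerivAt (fun u => truncDyn L Λ R u M)
      (∑ Z ∈ smallSubsets Λ R, localTerm L Λ Z (truncDyn L Λ R s M)) s :=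
  (hasDerivAt_exp_smul_apply _ M s).congr_deriv (truncGen_apply _)

theorem truncDyn_zero_apply (M : LocalAlg ι Λ) : truncDyn L Λ R 0 M = M := by
  have hzero : ((0 : ℝ) : ℂ) • LinearMap.toContinuousLinearMap (truncGen L Λ R) = 0 :=
    ContinuousLinearMap.ext fun M => by simp
  rw [truncDyn, hzero, NormedSpace.exp_zero, one_apply_eq_self]

theorem norm_extend_truncDyn_le_duhamelMajorant (hL : IsDissipativeInteraction L)
    (hLF : FNorm F L < ∞) (hX : X ⊆ Λ) (hY : Y ⊆ Λ) (A : LocalAlg ι X)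
    {K : LocalAlg ι Y →ₗ[ℂ] LocalAlg ι Y} (hK : K ∈ CB₀ Y) (ht : 0 ≤ t) (n : ℕ) :
    ‖extend hY K (truncDyn L Λ R t (embed hX A))‖ ≤ (cbNorm K).toReal * ‖A‖ *
      duhamelMajorant (smallSubsets Λ R) (fun Z => (cbNorm (L Z)).toReal) X n Y t := by
  have hw : (0 : Finset Γ → ℝ) ≤ fun Z => (cbNorm (L Z)).toReal := fun _ => ENNReal.toReal_nonneg
  have hP (Z : Finset Γ) (hZ : Z ∈ smallSubsets Λ R) : Z ⊆ Λ := subset_of_mem_smallSubsets hZ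
  set κ : LocalAlg ι Λ →L[ℝ] LocalAlg ι Λ :=
    (LinearMap.toContinuousLinearMap (extend hY K)).restrictScalars ℝ
  have norm_κ_le : ‖κ‖ ≤ (cbNorm K).toReal :=
    κ.opNorm_le_bound ENNReal.toReal_nonneg (norm_extend_le hY hK.1)
  have hκ : IsLocalizedIn (smallSubsets Λ R) (localTerm L Λ) X
      (truncDyn L Λ R 0 (embed hX A)) Y κ :=
    (truncDyn_zero_apply (embed hX A)).symm ▸ isLocalizedIn_extend hP hX hY A hK.2
  have hloc : ∀ Z ∈ smallSubsets Λ R, IsLocalizedIn (smallSubsets Λ R) (localTerm L Λ) X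
      (truncDyn L Λ R 0 (embed hX A)) Z (localTerm L Λ Z) := fun Z hZ =>
    (truncDyn_zero_apply (embed hX A)).symm ▸
      isLocalizedIn_localTerm hP hX (hP Z hZ) A (hL Z).map_one
  have duhamel : ‖κ (truncDyn L Λ R t (embed hX A))‖ ≤ ‖κ‖ * ‖truncDyn L Λ R 0 (embed hX A)‖ * _ :=
    hκ.norm_apply_le hw (fun Z hZ => isDissipative_localTerm (hP Z hZ) (hL Z))
      (fun Z hZ hne => norm_localTerm_le (hP Z hZ) (cbNorm_lt_top hLF hne)) hloc
      (hasDerivAt_truncDyn_apply _) n ht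
  rw [truncDyn_zero_apply] at duhamel
  refine duhamel.trans ?_
  have := duhamelMajorant_nonneg (P := smallSubsets Λ R) (X := X) (Y := Y) hw n ht
  gcongr
  exact norm_embed_le hX A

theorem iterate_overlapSum_cbNorm_le (hF₀ : 0 < F 0) (hconv : ∃ C, IsConvBound Γ F C)
    (hLF : FNorm F L < ∞) (hXY : Disjoint X Y) (j : ℕ) :
    (overlapSum (smallSubsets Λ R) fun Z => (cbNorm (L Z)).toReal)^[j] (meetIndicator X) Y ≤
      (∑ x ∈ X, ∑ y ∈ Y, (F (nndist x y) : ℝ)) / convConst Γ F *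
        ((FNorm F L).toReal * convConst Γ F) ^ j := by
  rcases j with - | j
  · rw [Function.iterate_zero_apply, meetIndicator, if_pos hXY.symm]
    positivity
  · have chain := iterate_overlapSum_meetIndicator_le (X := X)
      (f := fun x y => (F (nndist x y) : ℝ)) (fun Z => ENNReal.toReal_nonneg)
      (fun Z hZ => subset_of_mem_smallSubsets hZ) (fun x y => NNReal.coe_nonneg _)
      ENNReal.toReal_nonneg (NNReal.coe_nonneg _) (sum_cbNorm_le hLF (smallSubsets Λ R))
      (sum_mul_le_convConst hconv Λ) j Y
    rw [Finset.sum_comm] at chain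
    simp only [nndist_comm] at chain
    refine chain.trans_eq ?_
    rcases isEmpty_or_nonempty Γ with hΓ | hΓ
    · simp [Finset.eq_empty_of_isEmpty X]
    · have hC : (convConst Γ F : ℝ) ≠ 0 := by exact_mod_cast (convConst_pos hF₀ hconv).ne'
      field_simp
      ring

theorem duhamelMajorant_cbNorm_le (hF₀ : 0 < F 0) (hconv : ∃ C, IsConvBound Γ F C)
    (hLF : FNorm F L < ∞) (hXY : Disjoint X Y) (ht : 0 ≤ t) (hR : 0 < R) (n : ℕ) :
    duhamelMajorant (smallSubsets Λ R) (fun Z => (cbNorm (L Z)).toReal) X n Y t ≤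
      (∑ x ∈ X, ∑ y ∈ Y, (F (nndist x y) : ℝ)) / convConst Γ F *
        expTail ((FNorm F L).toReal * convConst Γ F * t) (setDist X Y / R) +
      (t * ∑ Z ∈ smallSubsets Λ R, (cbNorm (L Z)).toReal) ^ n / n.factorial := by
  refine add_le_add ?_ ?_
  · exact sum_pow_div_factorial_mul_le_expTail ht (by positivity) (by positivity)
      (fun j hj => iterate_overlapSum_eq_zero_of_lt hR (fun Z hZ => (Finset.mem_filter.1 hZ).2) hj)
      (iterate_overlapSum_cbNorm_le hF₀ hconv hLF hXY) n
  · rw [mul_pow, mul_div_right_comm]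
    gcongr
    exact iterate_overlapSum_one_le (fun Z => ENNReal.toReal_nonneg) n Y

end Dynamics

end

end OpenSpin

theorem theorem2p1_general {Γ : Type*} [MetricSpace Γ] [DecidableEq Γ]
    {ι : Γ → Type*} [∀ x, Fintype (ι x)] [∀ x, DecidableEq (ι x)]
    {F : ℝ≥0 → ℝ≥0} (hF₀ : 0 < F 0) (hconv : ∃ C, OpenSpin.IsConvBound Γ F C)
    {L : ∀ Z : Finset Γ, OpenSpin.LocalAlg ι Z →ₗ[ℂ] OpenSpin.LocalAlg ι Z}
    (hL : OpenSpin.IsDissipativeInteraction L) (hLF : OpenSpin.FNorm F L < ∞)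
    {X Y : Finset Γ} (hXY : Disjoint X Y)
    {Λ : Finset Γ} (hX : X ⊆ Λ) (hY : Y ⊆ Λ)
    (A : OpenSpin.LocalAlg ι X)
    {K : OpenSpin.LocalAlg ι Y →ₗ[ℂ] OpenSpin.LocalAlg ι Y} (hK : K ∈ OpenSpin.CB₀ Y)
    {t R : ℝ} (ht : 0 ≤ t) (hR : 0 < R) :
    ‖OpenSpin.extend hY K (OpenSpin.truncDyn L Λ R t (OpenSpin.embed hX A))‖ ≤
      (OpenSpin.cbNorm K).toReal * ‖A‖ / (OpenSpin.convConst Γ F : ℝ) *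
        OpenSpin.expTail ((OpenSpin.FNorm F L).toReal * (OpenSpin.convConst Γ F : ℝ) * t)
          (OpenSpin.setDist X Y / R) *
        ∑ x ∈ X, ∑ y ∈ Y, (F (nndist x y) : ℝ) := by
  set l := ∑ Z ∈ OpenSpin.smallSubsets Λ R, (OpenSpin.cbNorm (L Z)).toReal
  set b := (∑ x ∈ X, ∑ y ∈ Y, (F (nndist x y) : ℝ)) / OpenSpin.convConst Γ F *
    OpenSpin.expTail ((OpenSpin.FNorm F L).toReal * (OpenSpin.convConst Γ F : ℝ) * t)
      (OpenSpin.setDist X Y / R) with hb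
  have norm_le (n : ℕ) : ‖OpenSpin.extend hY K (OpenSpin.truncDyn L Λ R t (OpenSpin.embed hX A))‖ ≤
      (OpenSpin.cbNorm K).toReal * ‖A‖ * (b + (t * l) ^ n / (n.factorial : ℝ)) := by
    refine (OpenSpin.norm_extend_truncDyn_le_duhamelMajorant hL hLF hX hY A hK ht n).trans ?_
    gcongr
    exact OpenSpin.duhamelMajorant_cbNorm_le hF₀ hconv hLF hXY ht hR n
  have remainder_tendsto := ((FloorSemiring.tendsto_pow_div_factorial_atTop (t * l)).const_add
    b).const_mul ((OpenSpin.cbNorm K).toReal * ‖A‖)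
  refine (ge_of_tendsto' remainder_tendsto norm_le).trans_eq ?_
  rw [hb]
  ring

theorem theorem2p1 {Γ : Type*} [MetricSpace Γ] [Countable Γ] [DecidableEq Γ]
    {ι : Γ → Type*} [∀ x, Fintype (ι x)] [∀ x, DecidableEq (ι x)]
    {F : ℝ≥0 → ℝ≥0} (hF : OpenSpin.IsFFunction Γ F)
    {L : ∀ Z : Finset Γ, OpenSpin.LocalAlg ι Z →ₗ[ℂ] OpenSpin.LocalAlg ι Z}
    (hL : OpenSpin.IsDissipativeInteraction L) (hLF : OpenSpin.FNorm F L < ∞)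
    {X Y : Finset Γ} (hXY : Disjoint X Y)
    {Λ : Finset Γ} (hX : X ⊆ Λ) (hY : Y ⊆ Λ)
    (A : OpenSpin.LocalAlg ι X)
    {K : OpenSpin.LocalAlg ι Y →ₗ[ℂ] OpenSpin.LocalAlg ι Y} (hK : K ∈ OpenSpin.CB₀ Y)
    {t R : ℝ} (ht : 0 ≤ t) (hR : 0 < R) :
    ‖OpenSpin.extend hY K (OpenSpin.truncDyn L Λ R t (OpenSpin.embed hX A))‖ ≤
      (OpenSpin.cbNorm K).toReal * ‖A‖ / (OpenSpin.convConst Γ F : ℝ) *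
        OpenSpin.expTail ((OpenSpin.FNorm F L).toReal * (OpenSpin.convConst Γ F : ℝ) * t)
          (OpenSpin.setDist X Y / R) *
        ∑ x ∈ X, ∑ y ∈ Y, (F (nndist x y) : ℝ) :=
  theorem2p1_general (hF.pos 0) (hF.convolution.imp fun _ => And.right) hL hLF hXY hX hY A hK ht hR
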